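/- **Theorem.** For a sequence $(g_k)_{k\ge 1}$ of non-negative integers put $$\Delta^E_{g_1g_2\ldots}=\sum_{n=1}^\infty\frac{1}{(2+g_1)(2+g_1+g_2)\cdots(2+g_1+\cdots+g_n)} .$$ By Engel's theorem every $x\in(0,1]$ can be written as $x=\Delta^E_{g_1(x)g_2(x)\ldots}$ for exactly one sequence $(g_k(x))$ of non-negative integers. Let $(u_n)_{n\ge 0}$ be real numbers such that $\sum_{n=0}^\infty u_n=1$ and, for every $n\ge 0$, $|u_n|<1$ and $0<r_n<1$, where $r_n=1-(u_0+\cdots+u_n)$. Define $f:[0,1]\to\mathbb R$ by $f(0)=0$ and $$f(x)=r_{g_1(x)}+\sum_{k=2}^\infty\Bigl(r_{g_k(x)}\prod_{i=1}^{k-1}u_{g_i(x)}\Bigr)\qquad(0<x\le 1).$$ Suppose that $u_n\ge 0$ for all $n$. Then: 1. $f$ is a (continuous) probability distribution function on $[0,1]$: it is non-decreasing and continuous with $f(0)=0$ and $f(1)=1$. Moreover, there exist independent identically distributed random variables $\eta_1,\eta_2,\ldots$ with $\mathsf P\{\eta_k=n\}=u_n$ for all $k\ge 1$, $n\ge 0$,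 and for any such sequence, on any probability space, $f$ is the distribution function of the random variable $\xi=\Delta^E_{\eta_1\eta_2\ldots}$, i.e. $f(x)=\mathsf P\{\xi<x\}=\mathsf P\{\xi\le x\}$ for all $x\in[0,1]$. 2. If $u_n>0$ for all $n\ge 0$, then $f$ is strictly increasing on $[0,1]$. 3. $f$ is purely absolutely continuous or purely singular. That is, either $f$ is differentiable almost everywhere on $(0,1)$ with $f'$ integrable and $f(x)=\int_0^x f'(t)\,dt$ for all $x\in[0,1]$; or $f$ is continuous on $[0,1]$ and $f'(x)=0$ for Lebesgue-almost every $x\in(0,1)$. -/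

import Mathlib

open MeasureTheory ProbabilityTheory Set Filter Topology

universe v

noncomputable section

/-- The value `Δ^E_{g₁g₂…}` of the Engel series with digits `g` (digits are indexed from `0`):
`∑ₙ 1 / ((2 + g₁)(2 + g₁ + g₂)⋯(2 + g₁ + ⋯ + gₙ))`. -/
def engelValue (g : ℕ → ℕ) : ℝ :=
  ∑' n : ℕ, 1 / ∏ k ∈ Finset.range (n + 1), (2 + ∑ i ∈ Finset.range (k + 1), (g i : ℝ))

/-- The digits of the `E`-representation of `x`: the sequence `g` with `Δ^E_g = x`.  By Engel's
theorem there is exactly one such sequence for every `x ∈ (0, 1]`; only such `x` are used. -/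
def engelDigits (x : ℝ) : ℕ → ℕ :=
  Classical.epsilon fun g => engelValue g = x

/-- The remainder `rₙ = 1 - (u₀ + ⋯ + uₙ)`. -/
def engelRemainder (u : ℕ → ℝ) (n : ℕ) : ℝ :=
  1 - ∑ i ∈ Finset.range (n + 1), u i

/-- The standing conditions on the parameters: `∑ uₙ = 1`, `|uₙ| < 1` and `0 < rₙ < 1`. -/
structure EngelParameters (u : ℕ → ℝ) : Prop where
  sum_eq_one : Tendsto (fun N => ∑ i ∈ Finset.range N, u i) atTop (𝓝 1)
  abs_lt_one : ∀ n, |u n| < 1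
  remainder_pos : ∀ n, 0 < engelRemainder u n
  remainder_lt_one : ∀ n, engelRemainder u n < 1

/-- The series `r_{g₁} + ∑_{k ≥ 2} r_{g_k} ∏_{i < k} u_{g_i}`. -/
def engelSeries (u : ℕ → ℝ) (g : ℕ → ℕ) : ℝ :=
  ∑' k : ℕ, engelRemainder u (g k) * ∏ i ∈ Finset.range k, u (g i)

open Classical in
/-- The function `f` on `[0, 1]`: `f(x)` is the above series at the digits of `x` for
`x ∈ (0, 1]`, and `f(0) = 0` (the values outside `[0, 1]` are irrelevant). -/
def engelFunction (u : ℕ → ℝ) (x : ℝ) : ℝ :=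
  if x ∈ Ioc (0 : ℝ) 1 then engelSeries u (engelDigits x) else 0

/-- `η₁, η₂, …` are independent, identically distributed random variables with
`P{η_k = n} = uₙ`. -/
structure IsIIDDigits {Ω : Type*} [MeasurableSpace Ω] (P : Measure Ω) (u : ℕ → ℝ)
    (η : ℕ → Ω → ℕ) : Prop where
  measurable : ∀ k, Measurable (η k)
  indep : iIndepFun η P
  law : ∀ k n, P.real {ω | η k ω = n} = u n

/-- A (continuous) probability distribution function on `[0, 1]`. -/
structure IsContinuousDistributionFunction (F : ℝ → ℝ) : Prop where
  monotone : MonotoneOn F (Icc 0 1)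
  continuous : ContinuousOn F (Icc 0 1)
  map_zero : F 0 = 0
  map_one : F 1 = 1

/-- A distribution function `F` on `[0, 1]` is purely absolutely continuous: it is differentiable
almost everywhere, `F'` is integrable, and `F(x) = ∫₀ˣ F'(t) dt`. -/
def IsPureAbsolutelyContinuous (F : ℝ → ℝ) : Prop :=
  (∀ᵐ x ∂volume.restrict (Ioo (0 : ℝ) 1), DifferentiableAt ℝ F x) ∧
    IntervalIntegrable (deriv F) volume 0 1 ∧
    ∀ x ∈ Icc (0 : ℝ) 1, F x = ∫ t in (0 : ℝ)..x, deriv F t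

/-- A distribution function `F` on `[0, 1]` is purely singular: it is continuous and `F' = 0`
(with the derivative existing) Lebesgue-almost everywhere. -/
def IsPureSingular (F : ℝ → ℝ) : Prop :=
  ContinuousOn F (Icc 0 1) ∧ ∀ᵐ x ∂volume.restrict (Ioo (0 : ℝ) 1), HasDerivAt F 0 x

end

/-! Splitting off the first factor of an Engel series leaves an Engel series started at a larger
number. This recursion confines the series with first digit `d`, started at `s`, to the interval
`(1/(s+d), 1/(s+d-1)]`; these intervals are disjoint, so the expansion is injective and reverses the
lexicographic order (`engelTail_lt`). Hence ξ < Δ_g exactly when the random digits exceed `g` at the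
first place of difference. Independence gives the event of a first difference at index `k` the
probability r_{g_k} ∏_{i<k} u_{g_i}, and summing over `k` produces the series defining `f`.
Continuity holds because the law of ξ has no atoms.

Purity is a zero-one law. Let `A` be a Lebesgue null set carrying the singular part of the law.
Permuting the first `k` digits keeps their sum, so on each cylinder it acts on values as an affine
map and preserves null sets (`volume_image_engelValue_permute`). The event ξ ∈ A is therefore
invariant up to null events, and by `hewitt_savage` it has probability 0 (absolutely continuous) or
1 (singular). Differentiation of measures turns this into a statement about `f`. -/

noncomputable section

/-! ### Engel series with a general start: recursion, order, continuity -/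

/-- The Engel series started at `s` instead of `2`. -/
def engelTail (s : ℝ) (g : ℕ → ℕ) : ℝ :=
  ∑' n : ℕ, 1 / ∏ k ∈ Finset.range (n + 1), (s + ∑ i ∈ Finset.range (k + 1), (g i : ℝ))

theorem engelValue_eq_engelTail (g : ℕ → ℕ) : engelValue g = engelTail 2 g := rfl

theorem engelTail_term_nonneg {s : ℝ} (hs : 2 ≤ s) (g : ℕ → ℕ) (n : ℕ) :
    0 ≤ 1 / ∏ k ∈ Finset.range (n + 1), (s + ∑ i ∈ Finset.range (k + 1), (g i : ℝ)) := by
  positivity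

theorem engelTail_term_le {s : ℝ} (hs : 2 ≤ s) (g : ℕ → ℕ) (n : ℕ) :
    1 / ∏ k ∈ Finset.range (n + 1), (s + ∑ i ∈ Finset.range (k + 1), (g i : ℝ))
      ≤ (1 / s) * (1 / s) ^ n := by
  rw [← pow_succ', one_div_pow]
  refine one_div_le_one_div_of_le (by positivity) ?_
  calc s ^ (n + 1) = ∏ _k ∈ Finset.range (n + 1), s := by simp
    _ ≤ _ := Finset.prod_le_prod (fun _ _ => by linarith) fun k _ => by
      have : (0 : ℝ) ≤ ∑ i ∈ Finset.range (k + 1), (g i : ℝ) := by positivity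
      linarith

theorem summable_geometric_bound {s : ℝ} (hs : 2 ≤ s) :
    Summable fun n : ℕ => (1 / s) * (1 / s) ^ n :=
  (summable_geometric_of_lt_one (by positivity)
    (by rw [div_lt_one (by linarith)]; linarith)).mul_left _

theorem summable_engelTail {s : ℝ} (hs : 2 ≤ s) (g : ℕ → ℕ) :
    Summable fun n : ℕ =>
      1 / ∏ k ∈ Finset.range (n + 1), (s + ∑ i ∈ Finset.range (k + 1), (g i : ℝ)) :=
  .of_nonneg_of_le (engelTail_term_nonneg hs g) (engelTail_term_le hs g)
    (summable_geometric_bound hs)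

theorem engelTail_le {s : ℝ} (hs : 2 ≤ s) (g : ℕ → ℕ) : engelTail s g ≤ 1 / (s - 1) := by
  have h1 : 1 / s < 1 := by rw [div_lt_one (by linarith)]; linarith
  calc engelTail s g ≤ ∑' n : ℕ, (1 / s) * (1 / s) ^ n :=
        (summable_engelTail hs g).tsum_le_tsum (engelTail_term_le hs g) (summable_geometric_bound hs)
    _ = 1 / (s - 1) := by
      rw [tsum_mul_left, tsum_geometric_of_lt_one (by positivity) h1]
      have : s - 1 ≠ 0 := by linarith
      have : s ≠ 0 := by linarith
      have : 1 - 1 / s ≠ 0 := by linarith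
      field_simp

theorem engelTail_pos {s : ℝ} (hs : 2 ≤ s) (g : ℕ → ℕ) : 0 < engelTail s g :=
  (summable_engelTail hs g).tsum_pos (engelTail_term_nonneg hs g) 0 (by
    simp only [zero_add, Finset.range_one, Finset.prod_singleton, Finset.sum_singleton]
    positivity)

theorem engelTail_eq {s : ℝ} (hs : 2 ≤ s) (g : ℕ → ℕ) :
    engelTail s g = (1 + engelTail (s + g 0) fun n => g (n + 1)) / (s + g 0) := by
  have h0 : s + g 0 ≠ 0 := by positivity
  have hterm : ∀ n : ℕ,
      1 / ∏ k ∈ Finset.range (n + 1 + 1), (s + ∑ i ∈ Finset.range (k + 1), (g i : ℝ)) =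
      1 / (s + g 0) * (1 / ∏ k ∈ Finset.range (n + 1),
        (s + g 0 + ∑ i ∈ Finset.range (k + 1), (g (i + 1) : ℝ))) := by
    intro n
    rw [Finset.prod_range_succ', one_div_mul_one_div]
    simp only [zero_add, Finset.range_one, Finset.sum_singleton]
    rw [mul_comm (s + (g 0 : ℝ))]
    congr 2
    refine Finset.prod_congr rfl fun k _ => ?_
    rw [Finset.sum_range_succ']
    ring
  unfold engelTail
  rw [(summable_engelTail hs g).tsum_eq_zero_add]
  simp_rw [hterm]
  rw [tsum_mul_left]
  simp only [zero_add, Finset.range_one, Finset.prod_singleton, Finset.sum_singleton]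
  field_simp

/-- First digit `d` forces a value above `1/(s+d)`, by positivity of the tail, and at most
`1/(s+d-1)`, by the geometric bound. Intervals for different `d` do not overlap. -/
theorem engelTail_lt_of_head_lt {s : ℝ} (hs : 2 ≤ s) {g h : ℕ → ℕ} (hlt : g 0 < h 0) :
    engelTail s h < engelTail s g := by
  have hcast : (g 0 : ℝ) + 1 ≤ h 0 := by exact_mod_cast hlt
  have hg0 : (0 : ℝ) ≤ g 0 := by positivity
  have hg := engelTail_pos (s := s + g 0) (by linarith) fun n => g (n + 1)
  have hh := engelTail_le (s := s + h 0) (by linarith) fun n => h (n + 1)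
  calc engelTail s h = (1 + engelTail (s + h 0) fun n => h (n + 1)) / (s + h 0) := engelTail_eq hs h
    _ ≤ (1 + 1 / (s + h 0 - 1)) / (s + h 0) :=
      div_le_div_of_nonneg_right (by linarith) (by linarith)
    _ = 1 / (s + h 0 - 1) := by
      have : s + h 0 - 1 ≠ 0 := by linarith
      have : s + h 0 ≠ 0 := by linarith
      field_simp
      ring
    _ ≤ 1 / (s + g 0) := one_div_le_one_div_of_le (by linarith) (by linarith)
    _ < (1 + engelTail (s + g 0) fun n => g (n + 1)) / (s + g 0) :=
      div_lt_div_of_pos_right (by linarith) (by linarith)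
    _ = engelTail s g := (engelTail_eq hs g).symm

/-- The Engel series reverses the lexicographic order. -/
theorem engelTail_lt {s : ℝ} (hs : 2 ≤ s) {g h : ℕ → ℕ} {k : ℕ} (heq : ∀ i < k, g i = h i)
    (hlt : g k < h k) : engelTail s h < engelTail s g := by
  induction k generalizing s g h with
  | zero => exact engelTail_lt_of_head_lt hs hlt
  | succ k ih =>
    have h0 := heq 0 (by omega)
    rw [engelTail_eq hs g, engelTail_eq hs h, h0]
    have hh0 : (0 : ℝ) ≤ h 0 := by positivity
    refine div_lt_div_of_pos_right ?_ (by linarith)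
    gcongr
    exact ih (by linarith) (fun i hi => heq (i + 1) (by omega)) hlt

theorem engelValue_lt {g h : ℕ → ℕ} {k : ℕ} (heq : ∀ i < k, g i = h i) (hlt : g k < h k) :
    engelValue h < engelValue g :=
  engelTail_lt le_rfl heq hlt

theorem exists_first_difference {g h : ℕ → ℕ} (hne : g ≠ h) :
    ∃ k, (∀ i < k, g i = h i) ∧ g k ≠ h k := by
  classical
  have hex : ∃ k, g k ≠ h k := Function.ne_iff.1 hne
  exact ⟨Nat.find hex, fun i hi => not_not.1 (Nat.find_min hex hi), Nat.find_spec hex⟩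

theorem engelValue_lt_iff {g h : ℕ → ℕ} :
    engelValue h < engelValue g ↔ ∃ k, (∀ i < k, h i = g i) ∧ g k < h k := by
  refine ⟨fun hlt => ?_, fun ⟨k, heq, hk⟩ => engelValue_lt (fun i hi => (heq i hi).symm) hk⟩
  obtain ⟨k, heq, hk⟩ := exists_first_difference (g := h) (h := g) (by rintro rfl; exact hlt.false)
  refine ⟨k, heq, hk.lt_or_gt.resolve_left fun hk' => ?_⟩
  exact (engelValue_lt heq hk').asymm hlt

theorem engelValue_injective : Function.Injective engelValue := by
  intro g h heq
  by_contra hne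
  obtain ⟨k, hk, hne⟩ := exists_first_difference hne
  rcases hne.lt_or_gt with hlt | hlt
  · exact (engelValue_lt hk hlt).ne' heq
  · exact (engelValue_lt (fun i hi => (hk i hi).symm) hlt).ne heq

theorem engelValue_mem_Ioc (g : ℕ → ℕ) : engelValue g ∈ Ioc (0 : ℝ) 1 :=
  ⟨engelTail_pos le_rfl g, (engelTail_le le_rfl g).trans (by norm_num)⟩

/-- With the first `k` digits fixed, the Engel series is an affine function of the remaining
series, which starts at `s` plus the sum of the fixed digits. -/
theorem exists_engelTail_eq_affine (k : ℕ) {s : ℝ} (hs : 2 ≤ s) (c : ℕ → ℕ) :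
    ∃ a b : ℝ, b ≠ 0 ∧ ∀ g : ℕ → ℕ, (∀ i < k, g i = c i) →
      engelTail s g =
        a + b * engelTail (s + ∑ i ∈ Finset.range k, (c i : ℝ)) fun n => g (n + k) := by
  induction k generalizing s c with
  | zero => exact ⟨0, 1, one_ne_zero, fun g _ => by simp⟩
  | succ k ih =>
    have hc : (0 : ℝ) ≤ c 0 := by positivity
    have hpos : s + c 0 ≠ 0 := by positivity
    obtain ⟨a, b, hb, hab⟩ := ih (s := s + c 0) (by linarith) fun n => c (n + 1)
    refine ⟨(1 + a) / (s + c 0), b / (s + c 0), div_ne_zero hb hpos, fun g hg => ?_⟩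
    rw [engelTail_eq hs g, hg 0 (by omega), hab _ fun i hi => hg (i + 1) (by omega),
      Finset.sum_range_succ']
    simp only [show ∀ n, n + k + 1 = n + (k + 1) from fun n => by omega]
    rw [show s + (∑ i ∈ Finset.range k, (c (i + 1) : ℝ) + c 0)
      = s + c 0 + ∑ i ∈ Finset.range k, (c (i + 1) : ℝ) by ring]
    ring

theorem continuous_engelValue : Continuous engelValue := by
  refine continuous_tsum (u := fun n : ℕ => (1 / 2 : ℝ) * (1 / 2) ^ n) (fun n => ?_)
    (summable_geometric_bound le_rfl) fun n g => ?_
  · refine continuous_const.div ?_ fun g => ?_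
    · refine continuous_finsetProd _ fun k _ => continuous_const.add ?_
      exact continuous_finsetSum _ fun i _ =>
        (continuous_of_discreteTopology (f := fun m : ℕ => (m : ℝ))).comp (continuous_apply i)
    · positivity
  · rw [Real.norm_of_nonneg (engelTail_term_nonneg le_rfl g n)]
    exact engelTail_term_le le_rfl g n

theorem measurable_engelValue : Measurable engelValue := continuous_engelValue.measurable

/-! ### Existence of the Engel expansion -/

/-- Partial expansion of the Engel series along a given orbit of the Engel algorithm. -/
theorem engelTail_eq_of_orbit {s : ℝ} (hs : 2 ≤ s) (g : ℕ → ℕ) (y : ℕ → ℝ)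
    (hy : ∀ n, y n * (s + ∑ i ∈ Finset.range (n + 1), (g i : ℝ)) = 1 + y (n + 1))
    (hb : ∀ n, |y n| ≤ 1) : engelTail s g = y 0 := by
  set p : ℕ → ℝ := fun n =>
    ∏ k ∈ Finset.range n, (s + ∑ i ∈ Finset.range (k + 1), (g i : ℝ)) with hp
  have hfac : ∀ k : ℕ, 0 < s + ∑ i ∈ Finset.range (k + 1), (g i : ℝ) := fun k => by positivity
  have hppos : ∀ n, 0 < p n := fun n => Finset.prod_pos fun k _ => hfac k
  -- The orbit relation telescopes; the remainder `y n / p n` vanishes because `y` is bounded and `p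
  -- n ≥ 2 ^ n`.
  have hpart : ∀ n, ∑ j ∈ Finset.range n, 1 / p (j + 1) = y 0 - y n / p n := by
    intro n
    induction n with
    | zero => simp [hp]
    | succ n ih =>
      have hsucc : p (n + 1) = p n * (s + ∑ i ∈ Finset.range (n + 1), (g i : ℝ)) :=
        Finset.prod_range_succ _ _
      have h1 := (hppos n).ne'
      have h2 := (hfac n).ne'
      rw [Finset.sum_range_succ, ih, hsucc]
      field_simp
      linear_combination -hy n
  have hlim : Tendsto (fun n => y n / p n) atTop (𝓝 0) := by
    have hgeom : Tendsto (fun n : ℕ => (1 / 2 : ℝ) ^ n) atTop (𝓝 0) :=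
      tendsto_pow_atTop_nhds_zero_of_lt_one (by norm_num) (by norm_num)
    refine squeeze_zero_norm (fun n => ?_) hgeom
    rw [norm_div, Real.norm_of_nonneg (hppos n).le, one_div_pow]
    refine div_le_div₀ zero_le_one (hb n) (by positivity) ?_
    calc (2 : ℝ) ^ n = ∏ _k ∈ Finset.range n, (2 : ℝ) := by simp
      _ ≤ _ := Finset.prod_le_prod (fun _ _ => by norm_num) fun k _ => by
        have : (0 : ℝ) ≤ ∑ i ∈ Finset.range (k + 1), (g i : ℝ) := by positivity
        linarith
  refine tendsto_nhds_unique (summable_engelTail hs g).hasSum.tendsto_sum_nat ?_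
  have := (tendsto_const_nhds (x := y 0)).sub hlim
  rw [sub_zero] at this
  exact this.congr fun n => (hpart n).symm

/-- One step of the Engel algorithm. -/
def engelStep (y : ℝ) : ℝ := y * (⌊1 / y⌋₊ + 1) - 1

theorem engelStep_pos {y : ℝ} (hy : 0 < y) : 0 < engelStep y := by
  have := Nat.lt_floor_add_one (1 / y)
  rw [div_lt_iff₀' hy] at this
  unfold engelStep
  linarith

/-- This bound makes the integer parts ⌊1/y⌋ non-decreasing along the orbit, so that their
differences are legitimate digits. -/
theorem engelStep_le {y : ℝ} (hy : 0 < y) (hy1 : y ≤ 1) : engelStep y ≤ 1 / ⌊1 / y⌋₊ := by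
  have h1 : 1 ≤ ⌊1 / y⌋₊ := Nat.le_floor (by rw [Nat.cast_one, le_div_iff₀ hy]; linarith)
  have h1' : (1 : ℝ) ≤ ⌊1 / y⌋₊ := by exact_mod_cast h1
  have h2 : (⌊1 / y⌋₊ : ℝ) ≤ 1 / y := Nat.floor_le (by positivity)
  have h3 : y * ⌊1 / y⌋₊ ≤ 1 := by rwa [le_div_iff₀' hy] at h2
  have h4 : y ≤ 1 / ⌊1 / y⌋₊ := by rwa [le_div_iff₀ (by linarith)]
  unfold engelStep
  linarith

/-- Engel's theorem: existence of the expansion. -/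
theorem exists_engelValue_eq {x : ℝ} (hx : x ∈ Ioc (0 : ℝ) 1) : ∃ g, engelValue g = x := by
  set y : ℕ → ℝ := fun n => engelStep^[n] x with hydef
  have hsucc : ∀ n, y (n + 1) = engelStep (y n) := fun n => Function.iterate_succ_apply' _ _ _
  have hfloor : ∀ {z : ℝ}, 0 < z → z ≤ 1 → 1 ≤ ⌊1 / z⌋₊ := fun {z} hz hz1 =>
    Nat.le_floor (by rw [Nat.cast_one, le_div_iff₀ hz]; linarith)
  have hmem : ∀ n, 0 < y n ∧ y n ≤ 1 := by
    intro n
    induction n with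
    | zero => exact hx
    | succ n ih =>
      rw [hsucc]
      refine ⟨engelStep_pos ih.1, (engelStep_le ih.1 ih.2).trans ?_⟩
      have : (1 : ℝ) ≤ ⌊1 / y n⌋₊ := by exact_mod_cast hfloor ih.1 ih.2
      rw [div_le_one (by linarith)]
      exact this
  set q : ℕ → ℕ := fun n => ⌊1 / y n⌋₊ with hq
  have hq1 : ∀ n, 1 ≤ q n := fun n => hfloor (hmem n).1 (hmem n).2
  have hmono : ∀ n, q n ≤ q (n + 1) := by
    intro n
    refine Nat.le_floor ?_
    have hpos := (hmem (n + 1)).1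
    have hle := engelStep_le (hmem n).1 (hmem n).2
    rw [← hsucc] at hle
    have hqn : (0 : ℝ) < q n := by exact_mod_cast hq1 n
    rw [le_div_iff₀ hpos]
    rw [le_div_iff₀ hqn] at hle
    linarith
  -- The denominators `q n + 1` must equal `2 + g 0 + ⋯ + g n`, which dictates `g`. The truncated
  -- subtractions are exact by `hq1` and `hmono`.
  obtain ⟨g, hg0, hgs⟩ : ∃ g : ℕ → ℕ, g 0 = q 0 - 1 ∧ ∀ n, g (n + 1) = q (n + 1) - q n :=
    ⟨fun n => Nat.casesOn n (q 0 - 1) fun m => q (m + 1) - q m, rfl, fun _ => rfl⟩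
  have hsum : ∀ n, ∑ i ∈ Finset.range (n + 1), (g i : ℝ) = q n - 1 := by
    intro n
    induction n with
    | zero => simp [hg0, Nat.cast_sub (hq1 0)]
    | succ n ih =>
      rw [Finset.sum_range_succ, ih, hgs, Nat.cast_sub (hmono n)]
      ring
  refine ⟨g, engelTail_eq_of_orbit le_rfl g y (fun n => ?_) fun n => ?_⟩
  · rw [hsum, hsucc, engelStep]
    ring
  · rw [abs_of_pos (hmem n).1]
    exact (hmem n).2

theorem engelValue_engelDigits {x : ℝ} (hx : x ∈ Ioc (0 : ℝ) 1) :
    engelValue (engelDigits x) = x :=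
  Classical.epsilon_spec (exists_engelValue_eq hx)

/-! ### The law of one digit and the product model -/

namespace EngelParameters

variable {u : ℕ → ℝ}

theorem hasSum (hu : EngelParameters u) (hnonneg : ∀ n, 0 ≤ u n) : HasSum u 1 :=
  (hasSum_iff_tendsto_nat_of_nonneg hnonneg 1).2 hu.sum_eq_one

/-- From `0 < r₀ < 1` comes `0 < u₀ < 1`, and every other weight is at most `1 - u₀`. A bound
uniform in `n` makes cylinder probabilities decay geometrically, which excludes atoms. -/
theorem exists_bound (hu : EngelParameters u) (hnonneg : ∀ n, 0 ≤ u n) :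
    ∃ c, 0 ≤ c ∧ c < 1 ∧ ∀ n, u n ≤ c := by
  have h0 : 0 < u 0 := by
    have := hu.remainder_lt_one 0
    simp only [engelRemainder, zero_add, Finset.range_one, Finset.sum_singleton] at this
    linarith
  have h1 := (abs_lt.1 (hu.abs_lt_one 0)).2
  refine ⟨max (u 0) (1 - u 0), le_max_of_le_left h0.le, max_lt h1 (by linarith), fun n => ?_⟩
  cases n with
  | zero => exact le_max_left _ _
  | succ n =>
    refine le_max_of_le_right ?_
    have hr := hu.remainder_pos (n + 1)
    rw [engelRemainder, Finset.sum_range_succ] at hr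
    have := Finset.single_le_sum (f := u) (s := Finset.range (n + 1)) (fun i _ => hnonneg i)
      (Finset.mem_range.2 n.succ_pos)
    linarith

/-- The law of a single digit. -/
def digitLaw (hu : EngelParameters u) (hnonneg : ∀ n, 0 ≤ u n) : PMF ℕ :=
  ⟨fun n => ENNReal.ofReal (u n), by
    have hsum := hu.hasSum hnonneg
    rw [← ENNReal.ofReal_one, ← hsum.tsum_eq, ENNReal.ofReal_tsum_of_nonneg hnonneg hsum.summable]
    exact ENNReal.summable.hasSum⟩

theorem isIIDDigits_infinitePi (hu : EngelParameters u) (hnonneg : ∀ n, 0 ≤ u n) :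
    IsIIDDigits (Measure.infinitePi fun _ : ℕ => (hu.digitLaw hnonneg).toMeasure) u
      fun k ω => ω k where
  measurable k := measurable_pi_apply k
  indep := iIndepFun_infinitePi (X := fun _ m => m) fun _ => measurable_id
  law k n := by
    have hpre : {ω : ℕ → ℕ | ω k = n} = (fun ω => ω k) ⁻¹' {n} := rfl
    rw [hpre, ← map_measureReal_apply (measurable_pi_apply k) (measurableSet_singleton n),
      Measure.infinitePi_map_eval, measureReal_def,
      PMF.toMeasure_apply_singleton _ _ (measurableSet_singleton n)]
    exact ENNReal.toReal_ofReal (hnonneg n)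

end EngelParameters

/-! ### The distribution function of the random Engel series -/

namespace IsIIDDigits

variable {u : ℕ → ℝ} {Ω : Type*} [MeasurableSpace Ω] {P : Measure Ω} {η : ℕ → Ω → ℕ}

theorem measurable_engelValue (h : IsIIDDigits P u η) :
    Measurable fun ω => engelValue fun k => η k ω :=
  _root_.measurable_engelValue.comp (measurable_pi_lambda _ h.measurable)

theorem measureReal_preimage (h : IsIIDDigits P u η) (k n : ℕ) : P.real (η k ⁻¹' {n}) = u n :=
  h.law k n

theorem measureReal_lt [IsProbabilityMeasure P] (h : IsIIDDigits P u η) (k n : ℕ) :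
    P.real (η k ⁻¹' Ioi n) = engelRemainder u n := by
  have hcompl : η k ⁻¹' Ioi n = (⋃ i ∈ Finset.range (n + 1), η k ⁻¹' {i})ᶜ := by
    ext ω
    simp only [mem_preimage, mem_Ioi, mem_compl_iff, mem_iUnion, Finset.mem_range,
      mem_singleton_iff]
    constructor
    · rintro h1 ⟨i, h2, h3⟩
      omega
    · intro h1
      by_contra h2
      exact h1 ⟨η k ω, by omega, rfl⟩
  have hmeas : ∀ i ∈ Finset.range (n + 1), MeasurableSet (η k ⁻¹' {i}) := fun i _ =>
    h.measurable k (measurableSet_singleton i)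
  rw [hcompl, probReal_compl_eq_one_sub (Finset.measurableSet_biUnion _ hmeas),
    measureReal_biUnion_finset (fun i _ j _ hij => ?_) hmeas, engelRemainder]
  · simp_rw [h.measureReal_preimage]
  · exact Disjoint.preimage _ (by simpa using hij)

theorem measureReal_biInter [IsProbabilityMeasure P] (h : IsIIDDigits P u η) (s : Finset ℕ)
    (A : ℕ → Set ℕ) :
    P.real (⋂ i ∈ s, η i ⁻¹' A i) = ∏ i ∈ s, P.real (η i ⁻¹' A i) := by
  rw [measureReal_def, h.indep.measure_inter_preimage_eq_mul s fun i _ => .of_discrete,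
    ENNReal.toReal_prod]
  rfl

/-- The event that the digits exceed `g` lexicographically, the first difference being at `k`. -/
theorem measureReal_first_difference [IsProbabilityMeasure P] (h : IsIIDDigits P u η)
    (g : ℕ → ℕ) (k : ℕ) :
    P.real {ω | (∀ i < k, η i ω = g i) ∧ g k < η k ω} =
      engelRemainder u (g k) * ∏ i ∈ Finset.range k, u (g i) := by
  have hset : {ω | (∀ i < k, η i ω = g i) ∧ g k < η k ω} =
      ⋂ i ∈ Finset.range (k + 1), η i ⁻¹' (if i < k then {g i} else Ioi (g i)) := by
    ext ω
    simp only [mem_ofPred_eq, mem_iInter, Finset.mem_range, mem_preimage]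
    constructor
    · rintro ⟨h1, h2⟩ i hi
      split_ifs with hik
      · exact h1 i hik
      · obtain rfl : i = k := by omega
        exact h2
    · intro h1
      refine ⟨fun i hi => ?_, ?_⟩
      · simpa [hi] using h1 i (by omega)
      · simpa using h1 k (by omega)
  rw [hset, h.measureReal_biInter, Finset.prod_range_succ, mul_comm]
  simp only [lt_irrefl, if_false, h.measureReal_lt]
  congr 1
  refine Finset.prod_congr rfl fun i hi => ?_
  rw [if_pos (Finset.mem_range.1 hi), h.measureReal_preimage]

theorem measurableSet_first_difference (h : IsIIDDigits P u η) (g : ℕ → ℕ) (k : ℕ) :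
    MeasurableSet {ω | (∀ i < k, η i ω = g i) ∧ g k < η k ω} := by
  have hm := h.measurable
  measurability

theorem measure_eq_zero [IsProbabilityMeasure P] (h : IsIIDDigits P u η)
    (hu : EngelParameters u) (hnonneg : ∀ n, 0 ≤ u n) (g : ℕ → ℕ) :
    P {ω | (fun k => η k ω) = g} = 0 := by
  obtain ⟨c, hc0, hc1, hc⟩ := hu.exists_bound hnonneg
  have hle : ∀ k : ℕ, P.real {ω | (fun k => η k ω) = g} ≤ c ^ k := fun k =>
    calc P.real {ω | (fun k => η k ω) = g}
        ≤ P.real (⋂ i ∈ Finset.range k, η i ⁻¹' {g i}) :=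
          measureReal_mono fun ω hω => by simp [← show (fun k => η k ω) = g from hω]
      _ = ∏ i ∈ Finset.range k, u (g i) := by
          rw [h.measureReal_biInter]
          simp_rw [h.measureReal_preimage]
      _ ≤ ∏ _i ∈ Finset.range k, c := Finset.prod_le_prod (fun i _ => hnonneg _) fun i _ => hc _
      _ = c ^ k := by simp
  rw [← measureReal_eq_zero_iff]
  exact le_antisymm (ge_of_tendsto' (tendsto_pow_atTop_nhds_zero_of_lt_one hc0 hc1) hle)
    measureReal_nonneg

theorem measure_engelValue_eq [IsProbabilityMeasure P] (h : IsIIDDigits P u η)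
    (hu : EngelParameters u) (hnonneg : ∀ n, 0 ≤ u n) (x : ℝ) :
    P {ω | engelValue (fun k => η k ω) = x} = 0 := by
  by_cases hx : ∃ g, engelValue g = x
  · obtain ⟨g, rfl⟩ := hx
    simp_rw [engelValue_injective.eq_iff]
    exact h.measure_eq_zero hu hnonneg g
  · push Not at hx
    simp [hx]

theorem measureReal_engelValue_lt [IsProbabilityMeasure P] (h : IsIIDDigits P u η)
    (g : ℕ → ℕ) :
    P.real {ω | engelValue (fun k => η k ω) < engelValue g} = engelSeries u g := by
  have hset : {ω | engelValue (fun k => η k ω) < engelValue g} =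
      ⋃ k, {ω | (∀ i < k, η i ω = g i) ∧ g k < η k ω} := by
    ext ω
    simp [engelValue_lt_iff]
  have hdisj : Pairwise (Function.onFun Disjoint
      fun k => {ω | (∀ i < k, η i ω = g i) ∧ g k < η k ω}) := by
    refine (pairwise_disjoint_on _).2 fun k l hkl => Set.disjoint_left.2 ?_
    rintro ω ⟨-, h1⟩ ⟨h2, -⟩
    exact h1.ne' (h2 k hkl)
  rw [hset, measureReal_def, measure_iUnion hdisj (h.measurableSet_first_difference g),
    ENNReal.tsum_toReal_eq fun _ => measure_ne_top _ _]
  exact tsum_congr fun k => h.measureReal_first_difference g k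

theorem measureReal_lt_eq_engelFunction [IsProbabilityMeasure P] (h : IsIIDDigits P u η)
    {x : ℝ} (hx : x ∈ Icc (0 : ℝ) 1) :
    P.real {ω | engelValue (fun k => η k ω) < x} = engelFunction u x := by
  rcases hx.1.eq_or_lt with rfl | hpos
  · simp [engelFunction, (engelValue_mem_Ioc _).1.not_gt]
  · have hx' : x ∈ Ioc (0 : ℝ) 1 := ⟨hpos, hx.2⟩
    rw [engelFunction, if_pos hx', ← h.measureReal_engelValue_lt, engelValue_engelDigits hx']

theorem measureReal_le_eq_engelFunction [IsProbabilityMeasure P] (h : IsIIDDigits P u η)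
    (hu : EngelParameters u) (hnonneg : ∀ n, 0 ≤ u n) {x : ℝ} (hx : x ∈ Icc (0 : ℝ) 1) :
    P.real {ω | engelValue (fun k => η k ω) ≤ x} = engelFunction u x := by
  rw [← h.measureReal_lt_eq_engelFunction hx]
  refine measureReal_congr ?_
  have : ∀ᵐ ω ∂P, engelValue (fun k => η k ω) ≠ x := by
    simpa [ae_iff] using h.measure_engelValue_eq hu hnonneg x
  filter_upwards [this] with ω hω
  exact propext ⟨fun hle => lt_of_le_of_ne hle hω, fun hlt => le_of_lt hlt⟩

theorem strictMonoOn_engelFunction [IsProbabilityMeasure P] (h : IsIIDDigits P u η)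
    (hu : EngelParameters u) (hpos : ∀ n, 0 < u n) : StrictMonoOn (engelFunction u) (Icc 0 1) := by
  intro x hx y hy hxy
  have hy' : y ∈ Ioc (0 : ℝ) 1 := ⟨hx.1.trans_lt hxy, hy.2⟩
  obtain ⟨g, rfl⟩ := exists_engelValue_eq hy'
  -- Some cylinder around the digits of `y` lies entirely to the right of `x`. Inside it, exceeding
  -- `g` at digit `k` has positive probability and places ξ strictly between `x` and `y`.
  obtain ⟨k, hk⟩ : ∃ k, ∀ d : ℕ → ℕ, (∀ i < k, d i = g i) → x < engelValue d := by
    rcases hx.1.eq_or_lt with rfl | hx0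
    · exact ⟨0, fun d _ => (engelValue_mem_Ioc d).1⟩
    · obtain ⟨c, rfl⟩ := exists_engelValue_eq ⟨hx0, hx.2⟩
      obtain ⟨k, heq, hlt⟩ := engelValue_lt_iff.1 hxy
      refine ⟨k + 1, fun d hd => engelValue_lt (k := k) (fun i hi => ?_) ?_⟩
      · rw [hd i (by omega), heq i hi]
      · rwa [hd k (by omega)]
  rw [← h.measureReal_le_eq_engelFunction hu (fun n => (hpos n).le) hx,
    ← h.measureReal_lt_eq_engelFunction hy]
  have hE : 0 < P.real {ω | (∀ i < k, η i ω = g i) ∧ g k < η k ω} := by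
    rw [h.measureReal_first_difference]
    exact mul_pos (hu.remainder_pos _) (Finset.prod_pos fun i _ => hpos _)
  calc P.real {ω | engelValue (fun k => η k ω) ≤ x}
      < P.real {ω | engelValue (fun k => η k ω) ≤ x} +
        P.real {ω | (∀ i < k, η i ω = g i) ∧ g k < η k ω} := by linarith
    _ = P.real ({ω | engelValue (fun k => η k ω) ≤ x} ∪
        {ω | (∀ i < k, η i ω = g i) ∧ g k < η k ω}) := by
      refine (measureReal_union (Set.disjoint_left.2 fun ω h1 h2 => ?_)
        (h.measurableSet_first_difference g k)).symm
      exact (hk _ h2.1).not_ge h1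
    _ ≤ P.real {ω | engelValue (fun k => η k ω) < engelValue g} := by
      refine measureReal_mono (union_subset (fun ω hω => lt_of_le_of_lt hω hxy) fun ω hω => ?_)
      exact engelValue_lt_iff.2 ⟨k, hω⟩

/-- On `[0, 1]`, `f` is the distribution function of the law of the random Engel series. -/
theorem cdf_eq_engelFunction [IsProbabilityMeasure P] (h : IsIIDDigits P u η)
    (hu : EngelParameters u) (hnonneg : ∀ n, 0 ≤ u n) {x : ℝ} (hx : x ∈ Icc (0 : ℝ) 1) :
    cdf (P.map fun ω => engelValue fun k => η k ω) x = engelFunction u x := by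
  have := Measure.isProbabilityMeasure_map (μ := P) h.measurable_engelValue.aemeasurable
  rw [cdf_eq_real, map_measureReal_apply h.measurable_engelValue measurableSet_Iic]
  exact h.measureReal_le_eq_engelFunction hu hnonneg hx

theorem continuous_cdf [IsProbabilityMeasure P] (h : IsIIDDigits P u η)
    (hu : EngelParameters u) (hnonneg : ∀ n, 0 ≤ u n) :
    Continuous (cdf (P.map fun ω => engelValue fun k => η k ω)) := by
  set μ := P.map fun ω => engelValue fun k => η k ω with hμ
  have : IsProbabilityMeasure μ :=
    Measure.isProbabilityMeasure_map h.measurable_engelValue.aemeasurable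
  refine continuous_iff_continuousAt.2 fun x => ?_
  have hx : (cdf μ).measure {x} = 0 := by
    rw [measure_cdf, hμ, Measure.map_apply h.measurable_engelValue (measurableSet_singleton x)]
    exact h.measure_engelValue_eq hu hnonneg x
  rw [StieltjesFunction.measure_singleton, ENNReal.ofReal_eq_zero] at hx
  rw [(monotone_cdf μ).continuousAt_iff_leftLim_eq_rightLim, StieltjesFunction.rightLim_eq]
  exact le_antisymm ((monotone_cdf μ).leftLim_le le_rfl) (by linarith)

theorem isContinuousDistributionFunction [IsProbabilityMeasure P] (h : IsIIDDigits P u η)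
    (hu : EngelParameters u) (hnonneg : ∀ n, 0 ≤ u n) :
    IsContinuousDistributionFunction (engelFunction u) where
  monotone x hx y hy hxy := by
    rw [← h.cdf_eq_engelFunction hu hnonneg hx, ← h.cdf_eq_engelFunction hu hnonneg hy]
    exact monotone_cdf _ hxy
  continuous := (h.continuous_cdf hu hnonneg).continuousOn.congr fun x hx =>
    (h.cdf_eq_engelFunction hu hnonneg hx).symm
  map_zero := by simp [engelFunction]
  map_one := by
    rw [← h.measureReal_le_eq_engelFunction hu hnonneg (right_mem_Icc.2 zero_le_one)]
    simp [(engelValue_mem_Ioc _).2]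

end IsIIDDigits

/-! ### The Hewitt-Savage zero-one law -/

/-- The permutation of `ℕ` which exchanges `[0, k)` and `[k, 2k)`. -/
def blockSwap (k : ℕ) : Equiv.Perm ℕ :=
  Function.Involutive.toPerm
    (fun i => if i < k then i + k else if i < 2 * k then i - k else i) (by
      intro i
      dsimp only
      split_ifs <;> omega)

theorem blockSwap_of_lt {k i : ℕ} (h : i < k) : blockSwap k i = i + k := if_pos h

theorem blockSwap_of_ge {k i : ℕ} (h : 2 * k ≤ i) : blockSwap k i = i :=
  (if_neg (by omega)).trans (if_neg (by omega))

open scoped symmDiff in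
/-- The Hewitt-Savage zero-one law. -/
theorem hewitt_savage {X : Type*} [MeasurableSpace X] (ν : Measure X) [IsProbabilityMeasure ν]
    {N : Set (ℕ → X)} (hN : MeasurableSet N)
    (hinv : ∀ (k : ℕ) (π : Equiv.Perm ℕ), (∀ i, k ≤ i → π i = i) →
      (fun ω i => ω (π i)) ⁻¹' N =ᵐ[Measure.infinitePi fun _ : ℕ => ν] N) :
    (Measure.infinitePi fun _ : ℕ => ν) N = 0 ∨ (Measure.infinitePi fun _ : ℕ => ν) N = 1 := by
  set m := Measure.infinitePi fun _ : ℕ => ν with hm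
  -- Approximate `N` within `ε` by a cylinder `C` on coordinates `0, …, a`. Swapping in the next
  -- block gives an independent copy of `C`, also within `ε` of `N`, so `m(C)²` is within `2ε` of
  -- `m(N)`; replacing `m(C)²` by `m(N)²` costs another `2ε`.
  have hclose : ∀ ε : ℝ, 0 < ε → |m.real N - m.real N * m.real N| ≤ 4 * ε := by
    intro ε hε
    obtain ⟨C, hC, hCN⟩ := exists_measure_symmDiff_lt_of_generateFrom_isSetRing (μ := m)
      (isSetRing_measurableCylinders (α := fun _ : ℕ => X))
      ⟨{univ}, countable_singleton _, by simpa using univ_mem_measurableCylinders fun _ : ℕ => X, by simp⟩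
      generateFrom_measurableCylinders.symm hN (ENNReal.ofReal_pos.2 hε)
    rw [measurableCylinders_nat] at hC
    simp only [mem_iUnion, mem_singleton_iff] at hC
    obtain ⟨a, S, hS, rfl⟩ := hC
    set C := cylinder (α := fun _ : ℕ => X) (Finset.Iic a) S with hCdef
    have hCm : MeasurableSet C := hS.cylinder _
    set σ : (ℕ → X) → ℕ → X := fun ω i => ω (blockSwap (a + 1) i) with hσ
    have hσm : Measurable σ := by fun_prop
    have hpres : MeasurePreserving σ m m :=
      ⟨hσm, Measure.map_infinitePi_infinitePi_of_inj (P := fun _ : ℕ => ν)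
        (blockSwap (a + 1)).injective⟩
    have hd1 : m.real (C ∆ N) ≤ ε := ENNReal.toReal_le_of_le_ofReal hε.le hCN.le
    have hd2 : m.real ((σ ⁻¹' C) ∆ N) ≤ ε := by
      have hae : σ ⁻¹' N =ᵐ[m] N := hinv (2 * (a + 1)) _ fun i hi => blockSwap_of_ge hi
      have hae' : ((σ ⁻¹' C) ∆ N : Set (ℕ → X)) =ᵐ[m] (σ ⁻¹' (C ∆ N) : Set (ℕ → X)) :=
        ae_eq_set_symmDiff (Filter.EventuallyEq.refl _ _) hae.symm
      rw [measureReal_congr hae', hpres.measureReal_preimage (hCm.symmDiff hN).nullMeasurableSet]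
      exact hd1
    have hindep : m.real (C ∩ σ ⁻¹' C) = m.real C * m.real C := by
      have hind : iIndepFun (fun (i : ℕ) (ω : ℕ → X) => ω i) m :=
        iIndepFun_infinitePi (X := fun _ x => x) fun _ => measurable_id
      have hind2 := hind.indepFun_finset (Finset.Iic a) (Finset.Ico (a + 1) (2 * (a + 1)))
        (Finset.disjoint_left.2 fun i hi hj => by
          simp only [Finset.mem_Iic, Finset.mem_Ico] at hi hj
          omega) fun i => measurable_pi_apply i
      -- Reads the second block as if it were the first, exhibiting `σ ⁻¹' C` as an event of the
      -- second block alone.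
      let ρ : (Finset.Ico (a + 1) (2 * (a + 1)) → X) → Finset.Iic a → X := fun z i =>
        z ⟨i.1 + (a + 1), by
          have := Finset.mem_Iic.1 i.2
          simp only [Finset.mem_Ico]
          omega⟩
      have hρ : Measurable ρ := measurable_pi_lambda _ fun i => measurable_pi_apply _
      have hpre : σ ⁻¹' C =
          (fun (ω : ℕ → X) (i : Finset.Ico (a + 1) (2 * (a + 1))) => ω i) ⁻¹' (ρ ⁻¹' S) := by
        have : (Finset.Iic a).restrict ∘ σ =
            ρ ∘ fun (ω : ℕ → X) (i : Finset.Ico (a + 1) (2 * (a + 1))) => ω i := by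
          ext ω i
          exact congrArg ω (blockSwap_of_lt (Nat.lt_succ_of_le (Finset.mem_Iic.1 i.2)))
        rw [hCdef, cylinder, ← preimage_comp, this, preimage_comp]
      have hprod := hind2.measure_inter_preimage_eq_mul S (ρ ⁻¹' S) hS (hρ hS)
      rw [← hpre] at hprod
      have hprod' : m (C ∩ σ ⁻¹' C) = m C * m (σ ⁻¹' C) := hprod
      rw [measureReal_def, hprod', ENNReal.toReal_mul, hpres.measure_preimage
        hCm.nullMeasurableSet]
      rfl
    have hb1 : |m.real C - m.real N| ≤ ε :=
      (abs_measureReal_sub_le_measureReal_symmDiff hCm.nullMeasurableSet hN.nullMeasurableSet).trans hd1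
    have hb2 : |m.real (C ∩ σ ⁻¹' C) - m.real N| ≤ 2 * ε := by
      refine (abs_measureReal_sub_le_measureReal_symmDiff (hCm.inter (hσm hCm)).nullMeasurableSet
        hN.nullMeasurableSet).trans ?_
      calc m.real ((C ∩ σ ⁻¹' C) ∆ N) ≤ m.real (C ∆ N ∪ (σ ⁻¹' C) ∆ N) := by
            refine measureReal_mono fun ω hω => ?_
            simp only [mem_symmDiff, mem_union, mem_inter_iff] at hω ⊢
            tauto
        _ ≤ m.real (C ∆ N) + m.real ((σ ⁻¹' C) ∆ N) := measureReal_union_le _ _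
        _ ≤ 2 * ε := by linarith
    rw [hindep] at hb2
    have hC0 : 0 ≤ m.real C := measureReal_nonneg
    have hC1 : m.real C ≤ 1 := measureReal_le_one
    have hN0 : 0 ≤ m.real N := measureReal_nonneg
    have hN1 : m.real N ≤ 1 := measureReal_le_one
    rw [abs_le] at hb1 hb2 ⊢
    constructor <;> nlinarith
  have hzero : m.real N - m.real N * m.real N = 0 := by
    rw [← abs_nonpos_iff]
    refine le_of_forall_pos_le_add fun ε hε => ?_
    have := hclose (ε / 4) (by linarith)
    linarith
  have hcases : m.real N * (1 - m.real N) = 0 := by linarith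
  rcases mul_eq_zero.1 hcases with h0 | h1
  · exact Or.inl ((measureReal_eq_zero_iff).1 h0)
  · right
    have h1' : m.real N = 1 := by linarith
    rwa [measureReal_def, ENNReal.toReal_eq_one_iff] at h1'

/-! ### Purity of the law -/

theorem volume_preimage_affine_eq_zero {A : Set ℝ} (hA : volume A = 0) (a : ℝ) {b : ℝ}
    (hb : b ≠ 0) : volume ((fun x => a + b * x) ⁻¹' A) = 0 := by
  have hpre : (fun x => a + b * x) ⁻¹' A = (fun x => b * x) ⁻¹' ((fun x => a + x) ⁻¹' A) := rfl
  rw [hpre, Real.volume_preimage_mul_left hb, measure_preimage_add, hA, mul_zero]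

/-- Permuting finitely many digits carries Lebesgue null sets to Lebesgue null sets. -/
theorem volume_image_engelValue_permute {A : Set ℝ} (hA : volume A = 0) {k : ℕ}
    {π : Equiv.Perm ℕ} (hπ : ∀ i, k ≤ i → π i = i) :
    volume (engelValue '' {g | engelValue (fun i => g (π i)) ∈ A}) = 0 := by
  have hlt : ∀ i < k, π i < k := fun i hi => by
    by_contra hge
    have := π.injective (hπ (π i) (by omega))
    omega
  let ext : (Fin k → ℕ) → ℕ → ℕ := fun c i => if h : i < k then c ⟨i, h⟩ else 0
  -- There are only countably many prefixes of length `k`, so it suffices to fix one.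
  have hcover : engelValue '' {g | engelValue (fun i => g (π i)) ∈ A} ⊆
      ⋃ c : Fin k → ℕ, engelValue '' {g | (∀ i < k, g i = ext c i) ∧
        engelValue (fun i => g (π i)) ∈ A} := by
    rintro _ ⟨g, hg, rfl⟩
    exact mem_iUnion.2 ⟨fun i => g i, g, ⟨fun i hi => by simp [ext, hi], hg⟩, rfl⟩
  refine measure_mono_null hcover (measure_iUnion_null fun c => ?_)
  obtain ⟨a, b, hb, hab⟩ := exists_engelTail_eq_affine k le_rfl (ext c)
  obtain ⟨a', b', hb', hab'⟩ := exists_engelTail_eq_affine k le_rfl fun i => ext c (π i)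
  -- The crux: the prefix sum is unchanged, so the original and the permuted series have the same
  -- tail, with the same starting value. Eliminating that tail relates the two values by an affine
  -- map of slope `b' / b`.
  have hsum : ∑ i ∈ Finset.range k, (ext c (π i) : ℝ) = ∑ i ∈ Finset.range k, (ext c i : ℝ) :=
    Equiv.Perm.sum_comp π (Finset.range k) (fun i => (ext c i : ℝ)) fun i hi => by
      by_contra hge
      exact hi (hπ i (by simpa using hge))
  refine measure_mono_null ?_ (volume_preimage_affine_eq_zero hA (a' - b' / b * a)
    (div_ne_zero hb' hb))
  rintro _ ⟨g, ⟨hgc, hgA⟩, rfl⟩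
  have h1 := hab g hgc
  have h2 := hab' (fun i => g (π i)) fun i hi => hgc _ (hlt i hi)
  simp only [hsum, hπ _ (Nat.le_add_left k _)] at h2
  rw [mem_preimage]
  convert! hgA using 1
  rw [engelValue_eq_engelTail, engelValue_eq_engelTail, h1, h2]
  field_simp
  ring

/-- A null set which carries the singular part of a measure. -/
theorem exists_null_set_carrying_singular_part (μ : Measure ℝ) [IsFiniteMeasure μ] :
    ∃ A, MeasurableSet A ∧ volume A = 0 ∧ ∀ t, volume t = 0 → μ (t \ A) = 0 := by
  obtain ⟨S, hS, hs, hv⟩ := Measure.mutuallySingular_singularPart μ volume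
  refine ⟨Sᶜ, hS.compl, hv, fun t ht => ?_⟩
  rw [sdiff_compl]
  have h1 : μ.singularPart volume (t ∩ S) = 0 := measure_mono_null inter_subset_right hs
  have h2 : (volume.withDensity (μ.rnDeriv volume)) (t ∩ S) = 0 :=
    withDensity_absolutelyContinuous _ _ (measure_mono_null inter_subset_left ht)
  rw [Measure.haveLebesgueDecomposition_add μ volume, Measure.add_apply, h1, h2, add_zero]

/-- The law of an Engel series with i.i.d. digits is pure. -/
theorem engel_law_pure (ν : Measure ℕ) [IsProbabilityMeasure ν] :
    (Measure.infinitePi fun _ : ℕ => ν).map engelValue ≪ volume ∨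
      (Measure.infinitePi fun _ : ℕ => ν).map engelValue ⟂ₘ volume := by
  set m := Measure.infinitePi fun _ : ℕ => ν with hm
  obtain ⟨A, hA, hA0, hAs⟩ := exists_null_set_carrying_singular_part (m.map engelValue)
  have hpres : ∀ π : Equiv.Perm ℕ, MeasurePreserving (fun (ω : ℕ → ℕ) i => ω (π i)) m m :=
    fun π => ⟨by fun_prop,
      Measure.map_infinitePi_infinitePi_of_inj (P := fun _ : ℕ => ν) π.injective⟩
  have hsub : ∀ (k : ℕ) (π : Equiv.Perm ℕ), (∀ i, k ≤ i → π i = i) →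
      m ((fun ω i => ω (π i)) ⁻¹' (engelValue ⁻¹' A) \ engelValue ⁻¹' A) = 0 := by
    intro k π hπ
    -- A measurable null hull stands in for the image, whose measurability is not established.
    set t := toMeasurable volume (engelValue '' {g | engelValue (fun i => g (π i)) ∈ A}) with ht
    have ht0 : volume t = 0 := by
      rw [ht, measure_toMeasurable, volume_image_engelValue_permute hA0 hπ]
    have hmap := hAs t ht0
    rw [Measure.map_apply measurable_engelValue ((measurableSet_toMeasurable _ _).diff hA)] at hmap
    refine measure_mono_null ?_ hmap
    rintro ω ⟨h1, h2⟩
    exact ⟨subset_toMeasurable _ _ ⟨ω, h1, rfl⟩, h2⟩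
  have hN := measurable_engelValue hA
  have hae : ∀ (k : ℕ) (π : Equiv.Perm ℕ), (∀ i, k ≤ i → π i = i) →
      (fun ω i => ω (π i)) ⁻¹' (engelValue ⁻¹' A) =ᵐ[m] engelValue ⁻¹' A := by
    intro k π hπ
    refine ae_eq_set.2 ⟨hsub k π hπ, ?_⟩
    -- The reverse inclusion is the one already shown for `π⁻¹`, pulled back along the
    -- measure-preserving action of `π`.
    have hinv : ∀ i, k ≤ i → π⁻¹ i = i := fun i hi => by
      rw [Equiv.Perm.inv_eq_iff_eq, hπ i hi]
    have := hsub k π⁻¹ hinv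
    rw [← (hpres π).measure_preimage
      ((((hpres π⁻¹).measurable hN).diff hN).nullMeasurableSet)] at this
    simpa [preimage_sdiff, preimage_preimage] using this
  rcases hewitt_savage ν hN hae with h0 | h1
  · left
    refine Measure.AbsolutelyContinuous.mk fun t _ ht0 => ?_
    rw [← Measure.map_apply measurable_engelValue hA] at h0
    exact measure_mono_null (fun x hx => (em (x ∈ A)).elim (fun h => Or.inl h)
      fun h => Or.inr ⟨hx, h⟩) (measure_union_null h0 (hAs t ht0))
  · right
    refine ⟨Aᶜ, hA.compl, ?_, by rwa [compl_compl]⟩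
    rw [Measure.map_apply measurable_engelValue hA.compl, preimage_compl]
    exact (prob_compl_eq_zero_iff hN).2 h1

theorem EngelParameters.isPure {u : ℕ → ℝ} (hu : EngelParameters u) (hnonneg : ∀ n, 0 ≤ u n) :
    IsPureAbsolutelyContinuous (engelFunction u) ∨ IsPureSingular (engelFunction u) := by
  have h := hu.isIIDDigits_infinitePi hnonneg
  set m := Measure.infinitePi fun _ : ℕ => (hu.digitLaw hnonneg).toMeasure with hm
  set μ := m.map engelValue with hμ
  have : IsProbabilityMeasure μ :=
    Measure.isProbabilityMeasure_map measurable_engelValue.aemeasurable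
  have hcdf : ∀ x ∈ Icc (0 : ℝ) 1, cdf μ x = engelFunction u x := fun x hx =>
    h.cdf_eq_engelFunction hu hnonneg hx
  -- By Lebesgue differentiation the cdf has derivative `dμ/dx` almost everywhere. It agrees with
  -- `f` only on `[0, 1]`, hence the restriction to interior points, where agreement holds in a
  -- neighbourhood.
  have hderiv : ∀ᵐ x, x ∈ Ioo (0 : ℝ) 1 →
      HasDerivAt (engelFunction u) (μ.rnDeriv volume x).toReal x := by
    have hae := (cdf μ).ae_hasDerivAt
    rw [measure_cdf] at hae
    filter_upwards [hae] with x hx hmem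
    refine hx.congr_of_eventuallyEq ?_
    filter_upwards [Ioo_mem_nhds hmem.1 hmem.2] with y hy
    exact (hcdf y (Ioo_subset_Icc_self hy)).symm
  have hpure : μ ≪ volume ∨ μ ⟂ₘ volume := engel_law_pure _
  rcases hpure with hac | hsing
  · left
    have hint : Integrable (fun x => (μ.rnDeriv volume x).toReal) :=
      Measure.integrable_toReal_rnDeriv
    have hae : ∀ᵐ x, x ∈ Ioc (0 : ℝ) 1 →
        (μ.rnDeriv volume x).toReal = deriv (engelFunction u) x := by
      filter_upwards [hderiv, Measure.ae_ne volume (1 : ℝ)] with x hx hx1 hmem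
      exact (hx ⟨hmem.1, lt_of_le_of_ne hmem.2 hx1⟩).deriv.symm
    refine ⟨?_, ?_, fun x hx => ?_⟩
    · rw [ae_restrict_iff' measurableSet_Ioo]
      filter_upwards [hderiv] with x hx hmem using (hx hmem).differentiableAt
    · rw [intervalIntegrable_iff_integrableOn_Ioc_of_le zero_le_one]
      refine hint.integrableOn.congr ?_
      exact (ae_restrict_iff' measurableSet_Ioc).2 hae
    · have hxae : ∀ᵐ y, y ∈ Ioc (0 : ℝ) x →
          deriv (engelFunction u) y = (μ.rnDeriv volume y).toReal := by
        filter_upwards [hae] with y hy hmem using (hy ⟨hmem.1, hmem.2.trans hx.2⟩).symm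
      have hzero : cdf μ 0 = 0 := by
        rw [hcdf 0 (left_mem_Icc.2 zero_le_one)]
        simp [engelFunction]
      rw [intervalIntegral.integral_of_le hx.1, setIntegral_congr_ae measurableSet_Ioc hxae,
        Measure.setIntegral_toReal_rnDeriv hac, ← hcdf x hx, measureReal_def]
      conv_rhs => rw [← measure_cdf μ]
      rw [StieltjesFunction.measure_Ioc, hzero, sub_zero, ENNReal.toReal_ofReal (cdf_nonneg _ _)]
  · right
    refine ⟨(h.isContinuousDistributionFunction hu hnonneg).continuous, ?_⟩
    rw [ae_restrict_iff' measurableSet_Ioo]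
    filter_upwards [hderiv, hsing.rnDeriv_ae_eq_zero] with x hx hx0 hmem
    simpa [hx0] using hx hmem

end

theorem mainTheorem2 (u : ℕ → ℝ) (hu : EngelParameters u) (hnonneg : ∀ n, 0 ≤ u n) :
    -- `f` is a distribution function on `[0, 1]`
    IsContinuousDistributionFunction (engelFunction u) ∧
    -- i.i.d. digits with this law exist
    (∃ (Ω : Type) (_ : MeasurableSpace Ω) (P : Measure Ω) (η : ℕ → Ω → ℕ),
      IsProbabilityMeasure P ∧ IsIIDDigits P u η) ∧
    -- and, whenever they are given, `f` is the distribution function of `ξ = Δ^E_{η₁η₂…}`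
    (∀ (Ω : Type v) [MeasurableSpace Ω] (P : Measure Ω) [IsProbabilityMeasure P]
      (η : ℕ → Ω → ℕ), IsIIDDigits P u η →
        Measurable (fun ω => engelValue fun k => η k ω) ∧
        ∀ x ∈ Icc (0 : ℝ) 1,
          P.real {ω | engelValue (fun k => η k ω) < x} = engelFunction u x ∧
          P.real {ω | engelValue (fun k => η k ω) ≤ x} = engelFunction u x) ∧
    -- `f` is strictly increasing if all `uₙ` are positive
    ((∀ n, 0 < u n) → StrictMonoOn (engelFunction u) (Icc 0 1)) ∧
    -- `f` is pure
    (IsPureAbsolutelyContinuous (engelFunction u) ∨ IsPureSingular (engelFunction u)) := by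
  have h := hu.isIIDDigits_infinitePi hnonneg
  refine ⟨h.isContinuousDistributionFunction hu hnonneg, ⟨_, _, _, _, inferInstance, h⟩,
    fun Ω _ P _ η hη => ⟨hη.measurable_engelValue, fun x hx =>
      ⟨hη.measureReal_lt_eq_engelFunction hx,
        hη.measureReal_le_eq_engelFunction hu hnonneg hx⟩⟩,
    fun hpos => h.strictMonoOn_engelFunction hu hpos, hu.isPure hnonneg⟩
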